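/- Let $k$ be a commutative ring and let $\mathcal C$ be a small category with pairwise coproducts: every two objects $c_1,c_2$ have a coproduct $c_1\sqcup c_2$ (an initial object is not required). A representation of $\mathcal C$ is a functor $\mathcal F:\mathcal C\to \mathsf{Mod}(k)$; these form an abelian category $\mathsf{Mod}(k)^{\mathcal C}$ with enough injectives. For $n\ge 0$ let $\varprojlim^n:\mathsf{Mod}(k)^{\mathcal C}\to\mathsf{Mod}(k)$ be the $n$-th right derived functor of $\varprojlim$, and put $\varprojlim^{n}=0$ for $n<0$. For an object $c$ let $i_1,i_2:c\to c\sqcup c$ be the coprojections, and for a representation $\mathcal F$ let $$\mathsf T_{\mathcal F}:\mathcal F\oplus\mathcal F\longrightarrow \mathcal F_{\mathsf{sq}},\qquad \mathcal F_{\mathsf{sq}}(c)=\mathcal F(c\sqcup c),$$ be the natural transformation with components $\mathsf T_{\mathcal F,c}=(\mathcal F(i_1),\mathcal F(i_2)):\mathcal F(c)\oplus\mathcal F(c)\to\mathcal F(c\sqcup c)$. Put $\Sigma\mathcal F=\operatorname{coker}(\mathsf T_{\mathcal F})$. Call $\mathcal F$ monoadditive (respectively additive) if $\mathsf T_{\mathcal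 F}$ is a monomorphism (respectively an isomorphism), that is, if every $\mathsf T_{\mathcal F,c}$ is injective (respectively bijective). If $\mathcal F$ is monoadditive, then for every $n\ge 0$ there is an isomorphism of $k$-modules $$\varprojlim{}^{n}\,\mathcal F\;\cong\;\varprojlim{}^{n-1}\,\Sigma\mathcal F .$$ Consequently, $\varprojlim\mathcal F=0$ for every monoadditive representation $\mathcal F$, and $\varprojlim^{n}\mathcal F=0$ for all $n\ge 0$ for every additive representation $\mathcal F$. -/

import Mathlib

open CategoryTheory Limits

universe v u w

noncomputable section

namespace HigherLimits

variable {C : Type u} [Category.{v} C] {k : Type w} [CommRing k]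

/-! ### The functor category has enough injectives and `lim` is additive -/

instance hasLimitsOfShape_moduleCat :
    HasLimitsOfShape C (ModuleCat.{max u v w} k) := by
  have : UnivLE.{u, max u v w} := univLE_max.{u, max v w}
  exact (ModuleCat.hasLimitsOfSize.{v, u, max u v w}).has_limits_of_shape C

instance additive_lim :
    (lim : (C ⥤ ModuleCat.{max u v w} k) ⥤ ModuleCat.{max u v w} k).Additive := by
  have : (Functor.const C : ModuleCat.{max u v w} k ⥤ _).Additive := { map_add := rfl }
  exact constLimAdj.right_adjoint_additive

theorem enoughInjectives_moduleCat : EnoughInjectives (ModuleCat.{max u v w} k) := by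
  have : Small.{max u v w} k := small_max.{max u v} k
  infer_instance

theorem enoughInjectives_discrete (J : Type u) :
    EnoughInjectives (Discrete J ⥤ ModuleCat.{max u v w} k) where
  presentation F := by
    have := enoughInjectives_moduleCat.{v, u, w} (k := k)
    refine ⟨⟨Discrete.functor fun j => Injective.under (F.obj ⟨j⟩), ⟨?_⟩,
      Discrete.natTrans fun j => Injective.ι (F.obj j), ?_⟩⟩
    · intro X Y g f hf
      refine ⟨Discrete.natTrans fun j => ?_, ?_⟩
      · exact Injective.factorThru (J := Injective.under (F.obj j)) (g.app j) (f.app j)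
      · ext1
        ext1 j
        exact Injective.comp_factorThru (J := Injective.under (F.obj j)) (g.app j) (f.app j)
    · have : ∀ j, Mono ((Discrete.natTrans (G := Discrete.functor fun j =>
          Injective.under (F.obj ⟨j⟩)) fun j => Injective.ι (F.obj j)).app j) :=
        fun j => inferInstanceAs (Mono (Injective.ι (F.obj j)))
      exact NatTrans.mono_of_mono_app _

instance enoughInjectives_functor :
    EnoughInjectives (C ⥤ ModuleCat.{max u v w} k) := by
  let L : Discrete C ⥤ C := Discrete.functor id
  have := enoughInjectives_discrete.{v, u, w} (k := k) C
  have : ∀ F : Discrete C ⥤ ModuleCat.{max u v w} k, L.HasRightKanExtension F := by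
    intro F
    have : L.HasPointwiseRightKanExtension F := by
      intro Y
      have : UnivLE.{max u v, max u v w} := univLE_max.{max u v, w}
      have : HasLimitsOfShape (StructuredArrow Y L) (ModuleCat.{max u v w} k) :=
        (ModuleCat.hasLimitsOfSize.{u, max u v, max u v w}).has_limits_of_shape _
      exact inferInstanceAs (HasLimit (StructuredArrow.proj Y L ⋙ F))
    infer_instance
  have hmono : ∀ {F G : C ⥤ ModuleCat.{max u v w} k} (f : F ⟶ G),
      Mono f ↔ ∀ c, Mono (f.app c) := fun f => NatTrans.mono_iff_mono_app f
  have : ((Functor.whiskeringLeft _ _ (ModuleCat.{max u v w} k)).obj L).PreservesMonomorphisms :=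
    { preserves := fun f hf => by
        have := (hmono f).1 hf
        have : ∀ c, Mono ((((Functor.whiskeringLeft _ _ _).obj L).map f).app c) :=
          fun c => this c.as
        exact NatTrans.mono_of_mono_app _ }
  have : ((Functor.whiskeringLeft _ _ (ModuleCat.{max u v w} k)).obj L).ReflectsMonomorphisms :=
    { reflects := fun f hf => (hmono f).2 fun c =>
        (NatTrans.mono_iff_mono_app _).1 hf ⟨c⟩ }
  exact EnoughInjectives.of_adjunction (L.ranAdjunction (ModuleCat.{max u v w} k))

/-! ### Higher limits -/

/-- The higher limit functor `lim^n`: for `n ≥ 0` the `n`-th right derived functor of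
`lim : Mod(k)^C ⥤ Mod(k)`, and zero for `n < 0`. -/
def higherLim : ℤ → ((C ⥤ ModuleCat.{max u v w} k) ⥤ ModuleCat.{max u v w} k)
  | Int.ofNat n => lim.rightDerived n
  | Int.negSucc _ => (Functor.const _).obj (ModuleCat.of k PUnit)

/-! ### Additivity of representations of a category with pairwise coproducts -/

variable [HasBinaryCoproducts C]

variable (C) in
/-- The functor `c ↦ c ⨿ c`. -/
@[simps]
def sq : C ⥤ C where
  obj c := c ⨿ c
  map f := coprod.map f f

/-- The natural transformation `F ⟶ F ∘ sq` with components `F(i₁) : F(c) ⟶ F(c ⨿ c)`. -/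
@[simps]
def mapInl (F : C ⥤ ModuleCat.{max u v w} k) : F ⟶ sq C ⋙ F where
  app _ := F.map coprod.inl
  naturality _ _ f := (F.map_comp _ _).symm.trans
    ((congrArg F.map (coprod.inl_map f f).symm).trans (F.map_comp _ _))

/-- The natural transformation `F ⟶ F ∘ sq` with components `F(i₂) : F(c) ⟶ F(c ⨿ c)`. -/
@[simps]
def mapInr (F : C ⥤ ModuleCat.{max u v w} k) : F ⟶ sq C ⋙ F where
  app _ := F.map coprod.inr
  naturality _ _ f := (F.map_comp _ _).symm.trans
    ((congrArg F.map (coprod.inr_map f f).symm).trans (F.map_comp _ _))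

/-- The natural transformation `T_F : F ⊞ F ⟶ F ∘ sq` with components
`(F(i₁), F(i₂)) : F(c) ⊞ F(c) ⟶ F(c ⨿ c)`. -/
def addMap (F : C ⥤ ModuleCat.{max u v w} k) : F ⊞ F ⟶ sq C ⋙ F :=
  biprod.desc (mapInl F) (mapInr F)

/-- `F` is monoadditive if `T_F` is a monomorphism. -/
def IsMonoadditive (F : C ⥤ ModuleCat.{max u v w} k) : Prop := Mono (addMap F)

/-- `F` is additive if `T_F` is an isomorphism. -/
def IsAdditive (F : C ⥤ ModuleCat.{max u v w} k) : Prop := IsIso (addMap F)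

/-- `ΣF`, the cokernel of `T_F`. -/
def shift (F : C ⥤ ModuleCat.{max u v w} k) : C ⥤ ModuleCat.{max u v w} k :=
  cokernel (addMap F)

end HigherLimits

end

/-! Higher limits are `Ext` out of the constant representation (`nonempty_rightDerived_lim_iso`), so
the question concerns the long exact `Ext` sequence of `F ⊞ F ⟶ sq C ⋙ F ⟶ ΣF`. Both coprojections
induce the same map `Ext(F) → Ext(sq C ⋙ F)` (`comp_mapInl_eq_comp_mapInr`), and this map is
bijective with inverse induced by the fold map (`comp_mapFold_mapInl`). Under this identification
`T_F` becomes addition `(a, b) ↦ a + b`: it is onto, with kernel the antidiagonal. Hence the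
connecting map identifies `Ext^n(ΣF)` with the antidiagonal in `Ext^{n+1}(F)²`, and the first
projection identifies that with `Ext^{n+1}(F)`. -/

noncomputable section

namespace HigherLimits

open Abelian

/-! ### Degree zero: limits as morphisms out of the constant representation. -/

section Comparison

variable {C : Type u} [Category.{v} C] {k : Type w} [CommRing k]

instance hasExt_functor : HasExt.{max u v w} (C ⥤ ModuleCat.{max u v w} k) :=
  hasExt_of_enoughInjectives _

variable (C k) in
/-- The constant representation with value the free module of rank one. -/
abbrev constRep : C ⥤ ModuleCat.{max u v w} k :=
  (Functor.const C).obj (ModuleCat.of k (ULift.{max u v w} k))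

/-- A morphism from the constant representation to `F`, seen as an element of the limit of `F`. -/
def homToLim (F : C ⥤ ModuleCat.{max u v w} k) :
    (constRep C k ⟶ F) →ₗ[k] (lim.obj F : ModuleCat.{max u v w} k) where
  toFun f := (limit.lift F ⟨_, f⟩).hom ⟨1⟩
  map_add' f g := by
    have : limit.lift F ⟨_, f + g⟩ = limit.lift F ⟨_, f⟩ + limit.lift F ⟨_, g⟩ :=
      limit.hom_ext fun j => by simp [Preadditive.add_comp]
    rw [this]
    rfl
  map_smul' r f := by
    have : limit.lift F ⟨_, r • f⟩ = r • limit.lift F ⟨_, f⟩ :=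
      limit.hom_ext fun j => by simp
    rw [this]
    rfl

theorem homToLim_comp {F G : C ⥤ ModuleCat.{max u v w} k} (f : constRep C k ⟶ F) (g : F ⟶ G) :
    homToLim G (f ≫ g) = (lim.map g).hom (homToLim F f) := by
  have : limit.lift G ⟨_, f ≫ g⟩ = limit.lift F ⟨_, f⟩ ≫ lim.map g :=
    limit.hom_ext fun j => by simp
  exact congrArg (fun φ => φ.hom ⟨1⟩) this

theorem homToLim_bijective (F : C ⥤ ModuleCat.{max u v w} k) :
    Function.Bijective (homToLim F) := by
  have : Function.Bijective fun φ : ModuleCat.of k (ULift.{max u v w} k) ⟶ lim.obj F =>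
      φ.hom ⟨1⟩ := by
    constructor
    · intro φ ψ h
      ext x
      have hx : x = x.down • (⟨1⟩ : ULift.{max u v w} k) :=
        ULift.ext _ _ (mul_one x.down).symm
      rw [hx, map_smul, map_smul]
      exact congrArg (x.down • ·) h
    · intro x
      refine ⟨ModuleCat.ofHom ((LinearMap.toSpanSingleton k _ x).comp
        ULift.moduleEquiv.toLinearMap), ?_⟩
      exact one_smul k x
  refine this.comp (f := fun f : constRep C k ⟶ F => limit.lift F ⟨_, f⟩) ⟨fun f g h => ?_, fun φ =>
    ⟨{ app j := φ ≫ limit.π F j }, limit.hom_ext fun j => by simp⟩⟩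
  ext1
  ext1 j
  simpa using congrArg (· ≫ limit.π F j) h

/-- Morphisms from the constant representation to `F` form the limit of `F`. -/
def homEquivLim (F : C ⥤ ModuleCat.{max u v w} k) :
    (constRep C k ⟶ F) ≃ₗ[k] (lim.obj F : ModuleCat.{max u v w} k) :=
  LinearEquiv.ofBijective (homToLim F) (homToLim_bijective F)

theorem homEquivLim_comp {F G : C ⥤ ModuleCat.{max u v w} k} (f : constRep C k ⟶ F)
    (g : F ⟶ G) : homEquivLim G (f ≫ g) = (lim.map g).hom (homEquivLim F f) :=
  homToLim_comp f g

end Comparison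

/-! ### `Ext` as cocycles modulo coboundaries of an injective resolution. -/

section InjectiveResolution

variable {A : Type*} [Category A] [Abelian A] [HasExt.{w} A] {R : Type*} [Ring R] [Linear R A]

/-- Scaling is precomposition with `r • 𝟙 X`, with which `extMk` is compatible. -/
theorem extMk_smul {X Y : A} (I : InjectiveResolution Y) {n : ℕ} (r : R)
    (f : X ⟶ I.cocomplex.X n) (hf : f ≫ I.cocomplex.d n (n + 1) = 0) :
    I.extMk (r • f) (n + 1) rfl (by simp [hf]) = r • I.extMk f (n + 1) rfl hf := by
  have h : r • I.extMk f (n + 1) rfl hf =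
      (Ext.mk₀ (r • 𝟙 X)).comp (I.extMk f (n + 1) rfl hf) (zero_add _) := by
    rw [Ext.mk₀_smul, Ext.smul_comp, Ext.mk₀_id_comp]
  rw [h, I.mk₀_comp_extMk]
  simp

/-- The extension class of a cocycle with values in an injective resolution, as a linear map. -/
def extMkLinear (X : A) {Y : A} (I : InjectiveResolution Y) (n : ℕ) :
    LinearMap.ker (Linear.rightComp R X (I.cocomplex.d n (n + 1))) →ₗ[R] Ext X Y n where
  toFun f := I.extMk f.1 (n + 1) rfl f.2
  map_add' f g := (I.add_extMk f.1 g.1 (n + 1) rfl f.2 g.2).symm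
  map_smul' r f := extMk_smul I r f.1 f.2

theorem extMkLinear_surjective (X : A) {Y : A} (I : InjectiveResolution Y) (n : ℕ) :
    Function.Surjective (extMkLinear (R := R) X I n) := fun x => by
  obtain ⟨f, hf, rfl⟩ := I.extMk_surjective x (n + 1) rfl
  exact ⟨⟨f, hf⟩, rfl⟩

theorem extMkLinear_eq_zero_iff {X Y : A} (I : InjectiveResolution Y) (n : ℕ)
    (f : LinearMap.ker (Linear.rightComp R X (I.cocomplex.d (n + 1) (n + 2)))) :
    extMkLinear X I (n + 1) f = 0 ↔
      ∃ g : X ⟶ I.cocomplex.X n, g ≫ I.cocomplex.d n (n + 1) = f.1 :=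
  I.extMk_eq_zero_iff f.1 (n + 2) rfl f.2 n rfl

end InjectiveResolution

/-! ### Derived functors of `lim` as `Ext`-modules. -/

section Comparison

variable {C : Type u} [Category.{v} C] {k : Type w} [CommRing k]

/-- Evaluating `Hom(constRep, -)`-cocycles in the homology of the complex of limits. -/
def cocycleToHomology (K : CochainComplex (C ⥤ ModuleCat.{max u v w} k) ℕ) (n : ℕ) :
    LinearMap.ker (Linear.rightComp k (constRep C k) (K.d (n + 1) (n + 2))) →ₗ[k]
      (((lim.mapHomologicalComplex _).obj K).sc' n (n + 1) (n + 2)).moduleCatLeftHomologyData.H :=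
  (Submodule.mkQ _).comp ((homEquivLim (K.X (n + 1))).toLinearMap.restrict fun f hf => by
    have h := homEquivLim_comp f (K.d (n + 1) (n + 2))
    rw [show f ≫ K.d (n + 1) (n + 2) = 0 from hf, map_zero] at h
    exact h.symm)

theorem cocycleToHomology_surjective (K : CochainComplex (C ⥤ ModuleCat.{max u v w} k) ℕ) (n : ℕ) :
    Function.Surjective (cocycleToHomology K n) := by
  refine (Submodule.mkQ_surjective _).comp fun x => ?_
  obtain ⟨f, hf⟩ := (homEquivLim (K.X (n + 1))).surjective x.1
  refine ⟨⟨f, ?_⟩, Subtype.ext hf⟩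
  apply (homEquivLim (K.X (n + 2))).injective
  rw [map_zero]
  refine (homEquivLim_comp f (K.d (n + 1) (n + 2))).trans ?_
  rw [hf]
  exact x.2

theorem cocycleToHomology_eq_zero_iff (K : CochainComplex (C ⥤ ModuleCat.{max u v w} k) ℕ) (n : ℕ)
    (f : LinearMap.ker (Linear.rightComp k (constRep C k) (K.d (n + 1) (n + 2)))) :
    cocycleToHomology K n f = 0 ↔ ∃ g : constRep C k ⟶ K.X n, g ≫ K.d n (n + 1) = f.1 := by
  refine (Submodule.Quotient.mk_eq_zero _).trans ?_
  constructor
  · rintro ⟨y, hy⟩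
    obtain ⟨g, rfl⟩ := (homEquivLim (K.X n)).surjective y
    refine ⟨g, (homEquivLim (K.X (n + 1))).injective ?_⟩
    exact (homEquivLim_comp g (K.d n (n + 1))).trans (congrArg Subtype.val hy)
  · rintro ⟨g, hg⟩
    refine ⟨homEquivLim (K.X n) g, Subtype.ext ?_⟩
    refine (homEquivLim_comp g (K.d n (n + 1))).symm.trans ?_
    rw [hg]
    rfl

/-- Two surjective linear maps with the same kernel have isomorphic targets. -/
def linearEquivOfKerEq {R M N P : Type*} [Ring R] [AddCommGroup M] [AddCommGroup N]
    [AddCommGroup P] [Module R M] [Module R N] [Module R P] (f : M →ₗ[R] N) (g : M →ₗ[R] P)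
    (hf : Function.Surjective f) (hg : Function.Surjective g) (h : ∀ x, f x = 0 ↔ g x = 0) :
    N ≃ₗ[R] P :=
  (f.quotKerEquivOfSurjective hf).symm ≪≫ₗ
    Submodule.quotEquivOfEq _ _ (SetLike.ext fun x => by simpa using h x) ≪≫ₗ
    g.quotKerEquivOfSurjective hg

instance preservesFiniteLimits_lim :
    PreservesFiniteLimits (lim : (C ⥤ ModuleCat.{max u v w} k) ⥤ ModuleCat.{max u v w} k) :=
  have := constLimAdj (J := C) (C := ModuleCat.{max u v w} k).rightAdjoint_preservesLimits
  PreservesLimits.preservesFiniteLimits _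

/-- The derived functors of `lim` are `Ext`-modules out of the constant representation. -/
theorem nonempty_rightDerived_lim_iso (F : C ⥤ ModuleCat.{max u v w} k) (n : ℕ) :
    Nonempty (((lim : (C ⥤ ModuleCat.{max u v w} k) ⥤ _).rightDerived n).obj F ≅
      ModuleCat.of k (Ext.{max u v w} (constRep C k) F n)) := by
  cases n with
  | zero =>
    exact ⟨lim.rightDerivedZeroIsoSelf.app F ≪≫
      ((homEquivLim F).symm ≪≫ₗ (Ext.linearEquiv₀ (R := k)).symm).toModuleIso⟩
  | succ n =>
    let I := injectiveResolution F
    let K := (lim.mapHomologicalComplex (ComplexShape.up ℕ)).obj I.cocomplex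
    refine ⟨I.isoRightDerivedObj lim (n + 1) ≪≫
      K.homologyIsoSc' n (n + 1) (n + 2) (by simp) (by simp) ≪≫
      (K.sc' n (n + 1) (n + 2)).moduleCatHomologyIso ≪≫
      -- Both sides are quotients of the module of cocycles `constRep ⟶ I^(n+1)`, and both kernels
      -- consist of the coboundaries.
      (linearEquivOfKerEq (cocycleToHomology I.cocomplex n)
        (extMkLinear (constRep C k) I (n + 1)) (cocycleToHomology_surjective _ _)
        (extMkLinear_surjective _ _ _) fun f => ?_).toModuleIso⟩
    rw [cocycleToHomology_eq_zero_iff, extMkLinear_eq_zero_iff]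

theorem isZero_higherLim_of_isZero {F : C ⥤ ModuleCat.{max u v w} k} (hF : IsZero F) :
    ∀ n : ℤ, IsZero ((higherLim n).obj F)
  | Int.ofNat n => by
    obtain ⟨e⟩ := nonempty_rightDerived_lim_iso F n
    have : Subsingleton (Ext.{max u v w} (constRep C k) F n) :=
      subsingleton_of_forall_eq 0 fun x => by
        rw [← Ext.comp_mk₀_id x, hF.eq_of_src (𝟙 F) 0, Ext.mk₀_zero, Ext.comp_zero]
    exact (ModuleCat.isZero_of_subsingleton (ModuleCat.of k (Ext (constRep C k) F n))).of_iso e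
  | Int.negSucc _ => ModuleCat.isZero_of_subsingleton (ModuleCat.of k PUnit)

end Comparison

/-! ### The connecting map when two maps agree on `Ext`. -/

section Connecting

variable {A : Type*} [Category* A] [Abelian A] [HasExt.{w} A] {R : Type*} [CommRing R] [Linear R A]
  {X F G Q : A} {i j : F ⟶ G} {q : G ⟶ Q} {hq : biprod.desc i j ≫ q = 0}

variable (R X) in
/-- The connecting map of a short exact sequence `F ⊞ F ⟶ G ⟶ Q`, followed by the first
projection. -/
def connectingFst (hS : (ShortComplex.mk (biprod.desc i j) q hq).ShortExact) (n : ℕ) :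
    Ext X Q n →ₗ[R] Ext X F (n + 1) :=
  (Ext.bilinearCompOfLinear R X Q F n 1 (n + 1) rfl).flip
    (hS.extClass.comp (Ext.mk₀ (biprod.fst : F ⊞ F ⟶ F)) (add_zero 1))

theorem connectingFst_apply (hS : (ShortComplex.mk (biprod.desc i j) q hq).ShortExact) {n : ℕ}
    (x : Ext X Q n) :
    connectingFst R X hS n x = (x.comp hS.extClass rfl).comp
      (Ext.mk₀ (biprod.fst : F ⊞ F ⟶ F)) (add_zero _) :=
  (Ext.comp_assoc_of_third_deg_zero _ _ _ _).symm

/-- Suppose the connecting class of `x` has zero first component. Its second component is killed by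
`j`, hence vanishes because `p` retracts `j`. By exactness `x` comes from some `y` on `G`; since `y`
factors through `i` and `i ≫ q = 0`, also `x = 0`. -/
theorem connectingFst_injective (hS : (ShortComplex.mk (biprod.desc i j) q hq).ShortExact) {n : ℕ}
    {p : G ⟶ F} (hp : j ≫ p = 𝟙 F)
    (hpi : ∀ y : Ext X G n, y.comp (Ext.mk₀ (p ≫ i)) (add_zero n) = y) :
    Function.Injective (connectingFst R X hS n) := by
  refine (injective_iff_map_eq_zero _).2 fun x hx => ?_
  rw [connectingFst_apply] at hx
  have hzero : x.comp hS.extClass rfl = 0 := by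
    have he : (x.comp hS.extClass rfl).comp (Ext.mk₀ (biprod.desc i j)) (add_zero (n + 1)) = 0 := by
      rw [Ext.comp_assoc_of_third_deg_zero]
      exact (congrArg (fun z => x.comp z rfl) hS.extClass_comp).trans (Ext.comp_zero _ _ _ _ _)
    generalize x.comp hS.extClass rfl = e at hx he
    change Ext X (F ⊞ F) (n + 1) at e
    have hsum : e = (e.comp (Ext.mk₀ biprod.snd) (add_zero (n + 1))).comp (Ext.mk₀ biprod.inr)
        (add_zero (n + 1)) := by
      have h1 : e = e.comp (Ext.mk₀ (𝟙 (F ⊞ F))) (add_zero (n + 1)) := (Ext.comp_mk₀_id e).symm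
      rwa [← biprod.total, Ext.mk₀_add, Ext.comp_add, ← Ext.mk₀_comp_mk₀, ← Ext.mk₀_comp_mk₀,
        ← Ext.comp_assoc_of_third_deg_zero, ← Ext.comp_assoc_of_third_deg_zero, hx,
        Ext.zero_comp, zero_add] at h1
    have hsnd : e.comp (Ext.mk₀ biprod.snd) (add_zero (n + 1)) = 0 := by
      rw [hsum, Ext.comp_assoc_of_third_deg_zero, Ext.mk₀_comp_mk₀, biprod.inr_desc] at he
      have h' := congrArg (fun z => Ext.comp z (Ext.mk₀ p) (add_zero (n + 1))) he
      simpa only [Ext.comp_assoc_of_third_deg_zero, Ext.mk₀_comp_mk₀, Category.assoc,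
        hp, Category.comp_id, Ext.comp_mk₀_id, Ext.zero_comp] using h'
    rw [hsum, hsnd, Ext.zero_comp]
  obtain ⟨y, rfl⟩ := Ext.covariant_sequence_exact₃ X hS x rfl hzero
  have hfac : i ≫ q = 0 := by
    rw [← biprod.inl_desc i j, Category.assoc, hq, comp_zero]
  change Ext X G n at y
  change y.comp (Ext.mk₀ q) (add_zero n) = 0
  rw [← hpi y, Ext.comp_assoc_of_third_deg_zero, Ext.mk₀_comp_mk₀, Category.assoc, hfac, comp_zero,
    Ext.mk₀_zero, Ext.comp_zero]

/-- The antidiagonal class `(x, -x)` is killed by `(i, j)`, so by exactness it is a connecting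
class, and its first component is `x`. -/
theorem connectingFst_surjective (hS : (ShortComplex.mk (biprod.desc i j) q hq).ShortExact) {n : ℕ}
    (hij : ∀ x : Ext X F (n + 1),
      x.comp (Ext.mk₀ i) (add_zero _) = x.comp (Ext.mk₀ j) (add_zero _)) :
    Function.Surjective (connectingFst R X hS n) := fun x => by
  have h : (x.comp (Ext.mk₀ (biprod.lift (𝟙 F) (-𝟙 F))) (add_zero _)).comp
      (Ext.mk₀ (biprod.desc i j)) (add_zero _) = 0 := by
    rw [Ext.comp_assoc_of_third_deg_zero, Ext.mk₀_comp_mk₀, biprod.lift_desc]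
    simp [Ext.mk₀_add, hij]
  obtain ⟨y, hy⟩ := Ext.covariant_sequence_exact₁ X hS _ h rfl
  refine ⟨y, ?_⟩
  rw [connectingFst_apply, hy, Ext.comp_assoc_of_third_deg_zero, Ext.mk₀_comp_mk₀,
    biprod.lift_fst, Ext.comp_mk₀_id]

/-- If `i` and `j` agree on `Ext X F 0` and `F ⊞ F ⟶ G` is a monomorphism, then there are no
nonzero morphisms `X ⟶ F`. -/
theorem ext_zero_eq_zero [Mono (biprod.desc i j)]
    (hij : ∀ x : Ext X F 0, x.comp (Ext.mk₀ i) (add_zero _) = x.comp (Ext.mk₀ j) (add_zero _))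
    (x : Ext X F 0) : x = 0 := by
  obtain ⟨f, rfl⟩ := (Ext.mk₀_bijective _ _).2 x
  have h := hij (Ext.mk₀ f)
  rw [Ext.mk₀_comp_mk₀, Ext.mk₀_comp_mk₀] at h
  have h' : biprod.lift f (-f) ≫ biprod.desc i j = 0 := by
    simp [(Ext.mk₀_bijective _ _).1 h]
  have := congrArg (· ≫ biprod.fst) (zero_of_comp_mono _ h')
  rw [Ext.mk₀_eq_zero_iff]
  simpa using this

end Connecting

/-! ### The coprojections and the fold map on `Ext`. -/

variable {C : Type u} [Category.{v} C] [HasBinaryCoproducts C] {k : Type w} [CommRing k]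

/-- Precomposition with `sq`. -/
abbrev sqFunctor : (C ⥤ ModuleCat.{max u v w} k) ⥤ (C ⥤ ModuleCat.{max u v w} k) :=
  (Functor.whiskeringLeft C C (ModuleCat.{max u v w} k)).obj (sq C)

variable (C k) in
/-- The first coprojection, as a natural transformation of functors of the representation. -/
def mapInlNatTrans : 𝟭 (C ⥤ ModuleCat.{max u v w} k) ⟶ sqFunctor where
  app F := mapInl F
  naturality _ _ f := NatTrans.ext (funext fun _ => (f.naturality _).symm)

variable (C k) in
/-- The second coprojection, as a natural transformation of functors of the representation. -/
def mapInrNatTrans : 𝟭 (C ⥤ ModuleCat.{max u v w} k) ⟶ sqFunctor where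
  app F := mapInr F
  naturality _ _ f := NatTrans.ext (funext fun _ => (f.naturality _).symm)

/-- The natural transformation with components `F(c ⨿ c) ⟶ F(c)` induced by the fold map. -/
def mapFold (F : C ⥤ ModuleCat.{max u v w} k) : sq C ⋙ F ⟶ F where
  app c := F.map (coprod.desc (𝟙 c) (𝟙 c))
  naturality c d f := by
    refine (F.map_comp _ _).symm.trans (Eq.trans (congrArg F.map ?_) (F.map_comp _ _))
    change coprod.map f f ≫ coprod.desc (𝟙 d) (𝟙 d) = coprod.desc (𝟙 c) (𝟙 c) ≫ f
    ext <;> simp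

theorem mapInr_mapFold (F : C ⥤ ModuleCat.{max u v w} k) : mapInr F ≫ mapFold F = 𝟙 F := by
  ext1
  ext1 c
  exact (F.map_comp _ _).symm.trans
    ((congrArg F.map (coprod.inr_desc (𝟙 c) (𝟙 c))).trans (F.map_id c))

/-- The map `(c ⨿ c) ⨿ (c ⨿ c) ⟶ c ⨿ c` that sends the third copy of `c` to the second copy and the
three others to the first one. -/
abbrev thirdToInr (c : C) : (c ⨿ c) ⨿ (c ⨿ c) ⟶ c ⨿ c :=
  coprod.desc (coprod.desc coprod.inl coprod.inl) (coprod.desc coprod.inr coprod.inl)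

theorem map_inl_thirdToInr (c : C) :
    coprod.map coprod.inl coprod.inl ≫ thirdToInr c = 𝟙 (c ⨿ c) := by
  rw [coprod.map_desc, coprod.inl_desc, coprod.inl_desc]
  exact coprod.desc_inl_inr

theorem map_inr_thirdToInr (c : C) :
    coprod.map coprod.inr coprod.inr ≫ thirdToInr c = coprod.desc (𝟙 c) (𝟙 c) ≫ coprod.inl := by
  rw [coprod.map_desc, coprod.inr_desc, coprod.inr_desc, coprod.desc_comp, Category.id_comp]

/-- The natural transformation induced by `thirdToInr`. -/
def mapThird (F : C ⥤ ModuleCat.{max u v w} k) : sq C ⋙ sq C ⋙ F ⟶ sq C ⋙ F where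
  app c := F.map (thirdToInr c)
  naturality c d f := by
    refine (F.map_comp _ _).symm.trans (Eq.trans (congrArg F.map ?_) (F.map_comp _ _))
    change coprod.map (coprod.map f f) (coprod.map f f) ≫ thirdToInr d =
      thirdToInr c ≫ coprod.map f f
    ext <;> simp

theorem mapInl_mapThird (F : C ⥤ ModuleCat.{max u v w} k) :
    mapInl (sq C ⋙ F) ≫ mapThird F = 𝟙 _ := by
  ext1
  ext1 c
  refine (F.map_comp _ _).symm.trans (Eq.trans (congrArg F.map ?_) (F.map_id _))
  exact map_inl_thirdToInr c

theorem mapInr_mapThird (F : C ⥤ ModuleCat.{max u v w} k) :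
    mapInr (sq C ⋙ F) ≫ mapThird F = mapFold F ≫ mapInl F := by
  ext1
  ext1 c
  refine (F.map_comp _ _).symm.trans (Eq.trans (congrArg F.map ?_) (F.map_comp _ _))
  exact map_inr_thirdToInr c

/-- Both coprojections induce the same map on higher limits. -/
theorem comp_mapInl_eq_comp_mapInr {n : ℕ} {F : C ⥤ ModuleCat.{max u v w} k}
    (x : Ext (constRep C k) F n) :
    x.comp (Ext.mk₀ (mapInl F)) (add_zero n) = x.comp (Ext.mk₀ (mapInr F)) (add_zero n) := by
  induction n generalizing F with
  | zero =>
    obtain ⟨f, rfl⟩ := (Ext.mk₀_bijective _ _).2 x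
    rw [Ext.mk₀_comp_mk₀, Ext.mk₀_comp_mk₀]
    congr 1
    ext1
    ext1 c
    -- Both coprojections carry the value of a compatible family at `c` to its value at `c ⨿ c`.
    exact (f.naturality coprod.inl).symm.trans (f.naturality coprod.inr)
  | succ n ih =>
    -- Dimension shifting: `x` is a class `y` of degree `n` on the cokernel times the extension
    -- class, which is natural in the short exact sequence.
    let S := ShortComplex.mk (Injective.ι F) (cokernel.π (Injective.ι F)) (cokernel.condition _)
    have hS : S.ShortExact :=
      { exact := ShortComplex.exact_of_g_is_cokernel _ (cokernelIsCokernel _) }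
    have hS' : (S.map sqFunctor).ShortExact := hS.map_of_exact _
    obtain ⟨y, rfl⟩ := Ext.covariant_sequence_exact₁ _ hS x (Ext.eq_zero_of_injective _) rfl
    have hl := ShortComplex.ShortExact.extClass_naturality hS hS'
      (S.mapNatTrans (mapInlNatTrans C k))
    have hr := ShortComplex.ShortExact.extClass_naturality hS hS'
      (S.mapNatTrans (mapInrNatTrans C k))
    have key := ih y
    rw [Ext.comp_assoc_of_third_deg_zero, Ext.comp_assoc_of_third_deg_zero]
    refine (congrArg (fun z => y.comp z rfl) hl).trans
      (Eq.trans ?_ (congrArg (fun z => y.comp z rfl) hr).symm)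
    rw [← Ext.comp_assoc_of_second_deg_zero, ← Ext.comp_assoc_of_second_deg_zero]
    exact congrArg (fun z => Ext.comp z hS'.extClass rfl) key

/-- Apply the equality of the two coprojections to `sq C ⋙ F` and compose with `mapThird`: one side
becomes the identity, the other the fold map followed by the first coprojection. -/
theorem comp_mapFold_mapInl {n : ℕ} {F : C ⥤ ModuleCat.{max u v w} k}
    (y : Ext (constRep C k) (sq C ⋙ F) n) :
    y.comp (Ext.mk₀ (mapFold F ≫ mapInl F)) (add_zero n) = y := by
  rw [← mapInr_mapThird, ← Ext.mk₀_comp_mk₀, ← Ext.comp_assoc_of_third_deg_zero]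
  refine (congrArg (fun z => Ext.comp z (Ext.mk₀ (mapThird F)) (add_zero n))
    (comp_mapInl_eq_comp_mapInr y).symm).trans ?_
  refine (Ext.comp_assoc_of_third_deg_zero _ _ _ _).trans ?_
  refine (congrArg (fun z => y.comp z (add_zero n)) ((Ext.mk₀_comp_mk₀ _ _).trans
    (congrArg Ext.mk₀ (mapInl_mapThird F)))).trans (Ext.comp_mk₀_id y)

/-! ### The degree shift for monoadditive representations. -/

theorem IsMonoadditive.shortExact {F : C ⥤ ModuleCat.{max u v w} k} (hF : IsMonoadditive F) :
    (ShortComplex.mk (biprod.desc (mapInl F) (mapInr F)) (cokernel.π (addMap F))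
      (cokernel.condition (addMap F))).ShortExact where
  exact := ShortComplex.exact_of_g_is_cokernel _ (cokernelIsCokernel (addMap F))
  mono_f := hF
  epi_g := coequalizer.π_epi

/-- For monoadditive `F`, the connecting map shifts the degree of `Ext` by one. -/
def IsMonoadditive.extShiftEquiv {F : C ⥤ ModuleCat.{max u v w} k} (hF : IsMonoadditive F)
    (n : ℕ) : Ext (constRep C k) (shift F) n ≃ₗ[k] Ext (constRep C k) F (n + 1) :=
  LinearEquiv.ofBijective (connectingFst k (constRep C k) hF.shortExact n)
    ⟨connectingFst_injective hF.shortExact (mapInr_mapFold F) comp_mapFold_mapInl,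
      connectingFst_surjective hF.shortExact comp_mapInl_eq_comp_mapInr⟩

theorem isZero_higherLim_zero {F : C ⥤ ModuleCat.{max u v w} k} (hF : IsMonoadditive F) :
    IsZero ((higherLim 0).obj F) := by
  obtain ⟨e⟩ := nonempty_rightDerived_lim_iso F 0
  have : Subsingleton (Ext.{max u v w} (constRep C k) F 0) :=
    have : Mono (biprod.desc (mapInl F) (mapInr F)) := hF
    subsingleton_of_forall_eq 0 (ext_zero_eq_zero comp_mapInl_eq_comp_mapInr)
  exact (ModuleCat.isZero_of_subsingleton (ModuleCat.of k (Ext (constRep C k) F 0))).of_iso e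

theorem nonempty_higherLim_iso_shift {F : C ⥤ ModuleCat.{max u v w} k} (hF : IsMonoadditive F)
    (n : ℕ) : Nonempty ((higherLim (n : ℤ)).obj F ≅ (higherLim ((n : ℤ) - 1)).obj (shift F)) := by
  cases n with
  | zero =>
    -- In degree `-1` the higher limit is zero by definition, so this case amounts to the vanishing
    -- of `lim F`.
    have : IsZero ((higherLim (-1)).obj (shift F)) :=
      ModuleCat.isZero_of_subsingleton (ModuleCat.of k PUnit)
    exact ⟨(isZero_higherLim_zero hF).iso this⟩
  | succ n =>
    obtain ⟨e⟩ := nonempty_rightDerived_lim_iso F (n + 1)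
    obtain ⟨e'⟩ := nonempty_rightDerived_lim_iso (shift F) n
    rw [Nat.cast_succ, add_sub_cancel_right]
    exact ⟨e ≪≫ (hF.extShiftEquiv n).symm.toModuleIso ≪≫ e'.symm⟩

end HigherLimits

end

theorem mainTheorem8 {C : Type u} [Category.{v} C] [HasBinaryCoproducts C]
    {k : Type w} [CommRing k] :
    (∀ F : C ⥤ ModuleCat.{max u v w} k, HigherLimits.IsMonoadditive F →
      (∀ n : ℕ, Nonempty ((HigherLimits.higherLim (n : ℤ)).obj F ≅
        (HigherLimits.higherLim ((n : ℤ) - 1)).obj (HigherLimits.shift F))) ∧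
      IsZero (limit F)) ∧
    (∀ F : C ⥤ ModuleCat.{max u v w} k, HigherLimits.IsAdditive F →
      ∀ n : ℕ, IsZero ((HigherLimits.higherLim (n : ℤ)).obj F)) := by
  refine ⟨fun F hF => ⟨HigherLimits.nonempty_higherLim_iso_shift hF, ?_⟩, fun F hF n => ?_⟩
  · exact (HigherLimits.isZero_higherLim_zero hF).of_iso (lim.rightDerivedZeroIsoSelf.app F).symm
  · have : IsIso (HigherLimits.addMap F) := hF
    have hmono : HigherLimits.IsMonoadditive F := inferInstanceAs (Mono (HigherLimits.addMap F))
    obtain ⟨e⟩ := HigherLimits.nonempty_higherLim_iso_shift hmono n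
    exact (HigherLimits.isZero_higherLim_of_isZero
      (isZero_cokernel_of_epi (HigherLimits.addMap F)) _).of_iso e
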